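/- **Conventions.** An alphabet is a finite set $A$; $A^*$, $A^+$, $A^\omega$ denote the finite, nonempty finite, and infinite words over $A$. A class of languages (resp. of $\omega$-languages) $\mathcal{C}$ assigns to every alphabet $A$ a set $\mathcal{C}(A)$ of subsets of $A^*$ (resp. of $A^\omega$). A class $\mathcal{C}$ of $\omega$-languages is a *lattice* if every $\mathcal{C}(A)$ contains $\emptyset$ and $A^\omega$ and is closed under (binary) union and intersection. It is *closed under inverse image* if for all alphabets $A,B$, every monoid morphism $\varphi:A^*\to B^*$ (letters may be mapped to $\varepsilon$) and every $L\in\mathcal{C}(B)$, the set of all $a_0a_1a_2\cdots\in A^\omega$ such that $\varphi(a_0)\varphi(a_1)\varphi(a_2)\cdots$ is infinite and belongs to $L$ is in $\mathcal{C}(A)$. For $L_1,L_2\subseteq A^\omega$, $L_1$ is *$\mathcal{C}$-separable* from $L_2$ if there is $K\in\mathcal{C}(A)$ with $L_1\subseteq K$ and $K\cap L_2=\emptyset$. $\mathrm{SU}(A)$ is the set of finite Boolean combinations of languages $A^*w$ with $w\in A^*$; for $k\in\mathbb{N}$, $\mathrm{SU}_k(A)$ is the set of finite Boolean combinations of languages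 $A^*w$ with $w \in A^*$ and $|w|\le k$. For a finite partition $\mathbf{P}$ of $A^*$ let $\tau_{\mathbf{P}}:A^\omega\to(\mathbf{P}\times A)^\omega$ map $a_0a_1a_2\cdots$ to $(P_0,a_0)(P_1,a_1)(P_2,a_2)\cdots$, where $P_i\in\mathbf{P}$ is the part containing $a_0\cdots a_{i-1}$. For a class $\mathcal{C}$ of $\omega$-languages and a class $\mathcal{D}$ of languages of finite words, $(\mathcal{C}\circ\mathcal{D})(A)$ is the set of all $\tau_{\mathbf{P}}^{-1}(L)$ where $\mathbf{P}$ is a finite partition of $A^*$ into languages of $\mathcal{D}(A)$ and $L\in\mathcal{C}(\mathbf{P}\times A)$. An *$\omega$-semigroup* $(S_+,S_\omega)$ consists of a semigroup $S_+$ and a set $S_\omega$ with a mixed product $S_+\times S_\omega\to S_\omega$ and an infinite product $(S_+)^{\omega}\to S_\omega$, satisfying all forms of associativity; $(A^+,A^\omega)$ is one, and morphisms of $\omega$-semigroups preserve all the products. A morphism $\alpha:(A^+,A^\omega)\to(S_+,S_\omega)$ *recognizes* $L\subseteq A^\omega$ if $L=\alpha^{-1}(F)$ for some $F\subseteq S_\omega$.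 Given such an $\alpha$ with $S_+,S_\omega$ finite, let $S=\alpha(A^+)$, let $E(S)$ be the set of idempotents of $S$, let $\square\notin S$, and let $\mathbb{A}_\alpha=(E(S)\cup\{\square\})\times S\times E(S)$. A word of $\mathbb{A}_\alpha^\omega$ is *well-formed* if it is of the form $(\square,s_0,e_1)(e_1,s_1,e_2)(e_2,s_2,e_3)\cdots$ with all $e_i\in E(S)$. Let $\mathrm{eval}:(\mathbb{A}_\alpha^+,\mathbb{A}_\alpha^\omega)\to(S_+,S_\omega)$ be the morphism given on letters by $\mathrm{eval}((e,s,f))=esf$ and $\mathrm{eval}((\square,s,f))=sf$. For $L\subseteq A^\omega$ recognized by $\alpha$, put $$\mathrm{WF}_\alpha(L)=\{w\in\mathbb{A}_\alpha^\omega \mid w\text{ is well-formed and }\mathrm{eval}(w)\in\alpha(L)\}.$$ **Corollary 7.2.** Let $A$ be an alphabet, let $\alpha:(A^+,A^\omega)\to(S_+,S_\omega)$ be a morphism into a finite $\omega$-semigroup, let $\mathcal{C}$ be a lattice of $\omega$-languages closed under inverse image, and let $L_1,L_2\subseteq A^\omega$ be recognized by $\alpha$. Then the following are equivalent: 1. $L_1$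 is $(\mathcal{C}\circ\mathrm{SU})$-separable from $L_2$. 2. $L_1$ is $(\mathcal{C}\circ\mathrm{SU}_n)$-separable from $L_2$, where $n=2^{3|S_+|+1}$. 3. $\mathrm{WF}_\alpha(L_1)$ is $\mathcal{C}$-separable from $\mathrm{WF}_\alpha(L_2)$. -/

import Mathlib

/-! ### Finite words, infinite words, concatenations

An alphabet is a finite type `A`.  Finite words over `A` are lists (`A* = List A`), nonempty finite
words are elements of the free semigroup (`A⁺ = FreeSemigroup A`), infinite words are
sequences (`A^ω = ℕ → A`). -/

universe u v u' v'

namespace OmegaSep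

/-- The prefix `w 0 ⋯ w (n-1)` of length `n` of an infinite word `w`. -/
def pre {A : Type u} (w : ℕ → A) (n : ℕ) : List A := (List.range n).map w

/-- The finite word `x 0 ⋅ x 1 ⋯ x (n-1)`. -/
def cat {A : Type u} (x : ℕ → List A) (n : ℕ) : List A := (List.range n).flatMap x

/-- `IsConcat x w`: the infinite concatenation `x 0 ⋅ x 1 ⋅ x 2 ⋯` of the finite words `x i` (some of
which may be empty) is the infinite word `w`. -/
def IsConcat {A : Type u} (x : ℕ → List A) (w : ℕ → A) : Prop :=
  (∀ n, cat x n = pre w (cat x n).length) ∧ ∀ m, ∃ n, m < (cat x n).length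

/-- The list of letters of a nonempty word. -/
def letters {A : Type u} (x : FreeSemigroup A) : List A := x.head :: x.tail

/-- The sequence `s, f 0, f 1, f 2, …`. -/
def consSeq {X : Type u} (s : X) (f : ℕ → X) : ℕ → X
  | 0 => s
  | n + 1 => f n

/-- The finite product `f i * f (i+1) * ⋯ * f (i+d)` (with `d + 1` factors). -/
def segProd {S : Type u} [Mul S] (f : ℕ → S) (i : ℕ) : ℕ → S
  | 0 => f i
  | d + 1 => segProd f i d * f (i + d + 1)

theorem cat_succ {A : Type u} (x : ℕ → List A) (n : ℕ) : cat x (n + 1) = cat x n ++ x n := by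
  simp [cat, List.range_succ]

theorem cat_consSeq {A : Type u} (s : List A) (x : ℕ → List A) (n : ℕ) :
    cat (consSeq s x) (n + 1) = s ++ cat x n := by
  induction n with
  | zero => simp [cat, consSeq]
  | succ n ih => rw [cat_succ, ih, cat_succ x, List.append_assoc]; rfl

theorem pre_length {A : Type u} (w : ℕ → A) (n : ℕ) : (pre w n).length = n := by
  simp [pre]

theorem pre_get {A : Type u} (w : ℕ → A) (n i : ℕ) (h : i < n) :
    (pre w n)[i]? = some (w i) := by
  simp [pre, h]

theorem isConcat_unique {A : Type u} {x : ℕ → List A} {w w' : ℕ → A} (h : IsConcat x w)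
    (h' : IsConcat x w') : w = w' := by
  funext i
  obtain ⟨n, hn⟩ := h.2 i
  have h1 := pre_get w _ i hn
  have h2 := pre_get w' _ i hn
  rw [← h.1 n] at h1
  rw [← h'.1 n, h1] at h2
  exact Option.some.inj h2

theorem le_cat_letters {A : Type u} (f : ℕ → FreeSemigroup A) (n : ℕ) :
    n ≤ (cat (fun i => letters (f i)) n).length := by
  induction n with
  | zero => simp
  | succ n ih =>
    rw [cat_succ, List.length_append]
    have : 0 < (letters (f n)).length := by simp [letters]
    omega

/-- The infinite concatenation `f 0 ⋅ f 1 ⋅ f 2 ⋯` of nonempty words; its `i`-th letter is the `i`-th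
letter of `f 0 ⋯ f i`. -/
def wordProd {A : Type u} (f : ℕ → FreeSemigroup A) (i : ℕ) : A :=
  (cat (fun j => letters (f j)) (i + 1))[i]'(le_cat_letters f (i + 1))

/-- The concatenation of a nonempty finite word and an infinite word. -/
def wordAct {A : Type u} (x : FreeSemigroup A) (w : ℕ → A) (i : ℕ) : A :=
  if h : i < (letters x).length then (letters x)[i] else w (i - (letters x).length)

theorem cat_prefix {A : Type u} (x : ℕ → List A) (m d : ℕ) : cat x m <+: cat x (m + d) := by
  induction d with
  | zero => exact List.prefix_rfl
  | succ d ih => rw [← Nat.add_assoc, cat_succ]; exact ih.trans (List.prefix_append _ _)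

theorem isConcat_wordProd {A : Type u} (f : ℕ → FreeSemigroup A) :
    IsConcat (fun i => letters (f i)) (wordProd f) := by
  refine ⟨fun n => ?_, fun m => ⟨m + 1, le_cat_letters f (m + 1)⟩⟩
  apply List.ext_getElem?
  intro i
  by_cases hi : i < (cat (fun i => letters (f i)) n).length
  · rw [pre_get _ _ _ hi]
    have h1 : i < (cat (fun i => letters (f i)) (i + 1)).length := le_cat_letters f (i + 1)
    have key : ∀ (a b : ℕ), a ≤ b → i < (cat (fun i => letters (f i)) a).length →
        (cat (fun i => letters (f i)) a)[i]? = (cat (fun i => letters (f i)) b)[i]? := by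
      intro a b hab ha
      obtain ⟨d, rfl⟩ := Nat.exists_eq_add_of_le hab
      obtain ⟨t, ht⟩ := cat_prefix (fun i => letters (f i)) a d
      rw [← ht, List.getElem?_append_left ha]
    have : (cat (fun i => letters (f i)) n)[i]? = (cat (fun i => letters (f i)) (i + 1))[i]? := by
      rcases Nat.le_total n (i + 1) with h | h
      · exact key _ _ h hi
      · exact (key _ _ h h1).symm
    rw [this, List.getElem?_eq_getElem h1]
    rfl
  · rw [List.getElem?_eq_none (by omega), List.getElem?_eq_none (by rw [pre_length]; omega)]

theorem letters_mul {A : Type u} (x y : FreeSemigroup A) :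
    letters (x * y) = letters x ++ letters y := by
  simp [letters]

theorem cat_append_segProd {A : Type u} (f : ℕ → FreeSemigroup A) (i d : ℕ) :
    cat (fun j => letters (f j)) i ++ letters (segProd f i d) =
      cat (fun j => letters (f j)) (i + d + 1) := by
  induction d with
  | zero => simp [segProd, cat_succ]
  | succ d ih =>
    rw [segProd, letters_mul, ← List.append_assoc, ih, ← Nat.add_assoc, cat_succ _ (i + d + 1)]

theorem pre_wordAct {A : Type u} (x : FreeSemigroup A) (w : ℕ → A) (n : ℕ) :
    pre (wordAct x w) ((letters x).length + n) = letters x ++ pre w n := by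
  apply List.ext_getElem?
  intro i
  by_cases hi : i < (letters x).length + n
  · rw [pre_get _ _ _ hi]
    by_cases hx : i < (letters x).length
    · rw [List.getElem?_append_left hx, List.getElem?_eq_getElem hx, wordAct, dif_pos hx]
    · rw [List.getElem?_append_right (by omega), pre_get _ _ _ (by omega), wordAct, dif_neg hx]
  · rw [List.getElem?_eq_none (by rw [pre_length]; omega),
      List.getElem?_eq_none (by rw [List.length_append, pre_length]; omega)]

/-! ### ω-semigroups -/

/-- An ω-semigroup `(S, T)`: a semigroup `S`, a set `T`, a mixed product `S × T → T` and an infinite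
product `S^ω → T`, with all forms of associativity. -/
class OmegaSemigroup (S : Type u) (T : Type v) [Semigroup S] where
  /-- the mixed product -/
  act : S → T → T
  /-- the infinite product -/
  iprod : (ℕ → S) → T
  mul_act : ∀ (s t : S) (x : T), act (s * t) x = act s (act t x)
  act_iprod : ∀ (s : S) (f : ℕ → S), act s (iprod f) = iprod (consSeq s f)
  /-- Grouping the factors `f (k n), …, f (k (n+1) - 1)` for every `n` does not change the
  infinite product. -/
  iprod_regroup : ∀ (f : ℕ → S) (k : ℕ → ℕ), StrictMono k → k 0 = 0 →
    iprod (fun n => segProd f (k n) (k (n + 1) - k n - 1)) = iprod f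

/-- The ω-semigroup `(A⁺, A^ω)`. -/
instance wordOmegaSemigroup (A : Type u) : OmegaSemigroup (FreeSemigroup A) (ℕ → A) where
  act := wordAct
  iprod := wordProd
  mul_act s t x := by
    funext i
    have h := pre_get (wordAct (s * t) x) ((letters (s * t)).length + (i + 1)) i (by omega)
    have h' := pre_get (wordAct s (wordAct t x))
      ((letters s).length + ((letters t).length + (i + 1))) i (by omega)
    rw [pre_wordAct, letters_mul] at h
    rw [pre_wordAct, pre_wordAct, ← List.append_assoc, h] at h'
    exact Option.some.inj h'
  act_iprod s f := by
    refine isConcat_unique (x := fun i => letters (consSeq s f i)) ⟨fun n => ?_, fun m =>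
      ⟨m + 1, le_cat_letters _ (m + 1)⟩⟩ (isConcat_wordProd (consSeq s f))
    cases n with
    | zero => rfl
    | succ n =>
      have : (fun i => letters (consSeq s f i)) = consSeq (letters s) (fun i => letters (f i)) := by
        funext i
        cases i <;> rfl
      rw [this, cat_consSeq, List.length_append, pre_wordAct, ← (isConcat_wordProd f).1 n]
  iprod_regroup f k hk h0 := by
    have hcat : ∀ n, cat (fun i => letters (segProd f (k i) (k (i + 1) - k i - 1))) n =
        cat (fun i => letters (f i)) (k n) := by
      intro n
      induction n with
      | zero => rw [h0]; rfl
      | succ n ih =>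
        have := hk (Nat.lt_succ_self n)
        rw [cat_succ, ih, cat_append_segProd]
        congr 1
        simp only [Nat.succ_eq_add_one] at this
        omega
    refine isConcat_unique (isConcat_wordProd _) ⟨fun n => ?_, fun m =>
      ⟨m + 1, le_cat_letters (fun i => segProd f (k i) (k (i + 1) - k i - 1)) (m + 1)⟩⟩
    rw [hcat]
    exact (isConcat_wordProd f).1 (k n)

/-- A morphism of ω-semigroups `(S, T) → (S', T')`. -/
structure OmegaHom (S : Type u) (T : Type v) (S' : Type u') (T' : Type v') [Semigroup S]
    [Semigroup S'] [OmegaSemigroup S T] [OmegaSemigroup S' T'] where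
  /-- the component `S → S'`, a semigroup morphism -/
  fin : S →ₙ* S'
  /-- the component `T → T'` -/
  inf : T → T'
  map_act : ∀ (s : S) (x : T),
    inf (OmegaSemigroup.act s x) = OmegaSemigroup.act (fin s) (inf x)
  map_iprod : ∀ f : ℕ → S,
    inf (OmegaSemigroup.iprod f) = OmegaSemigroup.iprod (fun n => fin (f n))

theorem lift_eq_segProd {A : Type u} {S : Type v} [Semigroup S] (g : A → S) (w : ℕ → A)
    (i d : ℕ) (x : FreeSemigroup A) (hx : letters x = (List.range (d + 1)).map (fun j => w (i + j))) :
    FreeSemigroup.lift g x = segProd (fun n => g (w n)) i d := by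
  induction d generalizing x with
  | zero =>
    obtain ⟨a, l⟩ := x
    simp only [letters, zero_add, List.range_one, List.map_cons, List.map_nil, add_zero,
      List.cons.injEq] at hx
    obtain ⟨rfl, rfl⟩ := hx
    rfl
  | succ d ih =>
    rw [segProd, ← ih ⟨w i, (List.range d).map (fun j => w (i + (j + 1)))⟩ (by
      simp [letters, List.range_succ_eq_map, Function.comp_def])]
    obtain ⟨a, l⟩ := x
    have h2 : FreeSemigroup.mk a l =
        ⟨w i, (List.range d).map (fun j => w (i + (j + 1)))⟩ * FreeSemigroup.of (w (i + d + 1)) := by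
      rw [List.range_succ_eq_map, List.range_succ] at hx
      simp only [letters, List.map_cons, List.cons.injEq, add_zero] at hx
      obtain ⟨rfl, rfl⟩ := hx
      apply FreeSemigroup.ext
      · rfl
      · simp [FreeSemigroup.of, Function.comp_def, Nat.add_assoc]
    rw [h2, map_mul]
    rfl

/-- The morphism `(A⁺, A^ω) → (S, T)` generated by the images `g a` of the letters `a`. -/
def OmegaHom.lift {A : Type u} {S : Type u'} {T : Type v'} [Semigroup S] [OmegaSemigroup S T]
    (g : A → S) : OmegaHom (FreeSemigroup A) (ℕ → A) S T where
  fin := FreeSemigroup.lift g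
  inf w := OmegaSemigroup.iprod (fun i => g (w i))
  map_act s := by
    induction s using FreeSemigroup.recOnMul with
    | ih1 a =>
      intro x
      rw [FreeSemigroup.lift_of, OmegaSemigroup.act_iprod]
      congr 1
      funext i
      cases i <;> rfl
    | ih2 a b ha hb =>
      intro x
      rw [OmegaSemigroup.mul_act, ha, hb, map_mul, OmegaSemigroup.mul_act]
  map_iprod f := by
    have hw := isConcat_wordProd f
    have hlen : ∀ n, (cat (fun i => letters (f i)) (n + 1)).length =
        (cat (fun i => letters (f i)) n).length + ((f n).tail.length + 1) := by
      intro n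
      rw [cat_succ, List.length_append]
      rfl
    rw [← OmegaSemigroup.iprod_regroup
      (fun i => g ((OmegaSemigroup.iprod f : ℕ → A) i))
      (fun n => (cat (fun i => letters (f i)) n).length)
      (strictMono_nat_of_lt_succ fun n => by rw [hlen]; omega) rfl]
    congr 1
    funext n
    symm
    apply lift_eq_segProd g (wordProd f)
    have e1 := hw.1 n
    have e2 := hw.1 (n + 1)
    rw [cat_succ, List.length_append, pre, List.range_add, List.map_append] at e2
    have e3 := (List.append_inj e2 (by simp)).2
    rw [e3, List.map_map, hlen]
    simp [letters, Function.comp_def]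

/-- An ω-language is recognized by the morphism `α` when it is the preimage under `α` of some
set `F ⊆ T`. -/
def OmegaHom.Recognizes {A : Type u} {S : Type u'} {T : Type v'} [Semigroup S] [OmegaSemigroup S T]
    (α : OmegaHom (FreeSemigroup A) (ℕ → A) S T) (L : Set (ℕ → A)) : Prop :=
  ∃ F : Set T, L = α.inf ⁻¹' F

/-! ### Classes of languages and of ω-languages -/

/-- A class of languages of finite words: a set of languages for every alphabet. -/
def LangClass : Type (u + 1) := ∀ (A : Type u) [Finite A], Set (Set (List A))

/-- A class of ω-languages: a set of ω-languages for every alphabet. -/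
def OmegaClass : Type (u + 1) := ∀ (A : Type u) [Finite A], Set (Set (ℕ → A))

/-- A lattice of ω-languages: closed under finite unions and finite intersections, including
the empty ones. -/
structure OmegaClass.IsLattice (C : OmegaClass.{u}) : Prop where
  empty_mem : ∀ (A : Type u) [Finite A], (∅ : Set (ℕ → A)) ∈ C A
  univ_mem : ∀ (A : Type u) [Finite A], (Set.univ : Set (ℕ → A)) ∈ C A
  union_mem : ∀ (A : Type u) [Finite A] (K L : Set (ℕ → A)), K ∈ C A → L ∈ C A → K ∪ L ∈ C A
  inter_mem : ∀ (A : Type u) [Finite A] (K L : Set (ℕ → A)), K ∈ C A → L ∈ C A → K ∩ L ∈ C A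

/-- The inverse image of an ω-language `L` under a monoid morphism `φ : A* → B*`: the infinite
words `a₀a₁a₂⋯` such that `φ(a₀)φ(a₁)φ(a₂)⋯` is infinite and belongs to `L`.  The morphism may erase
letters. -/
def omegaPreimage {A B : Type u} (φ : FreeMonoid A →* FreeMonoid B) (L : Set (ℕ → B)) :
    Set (ℕ → A) :=
  {w | ∃ x ∈ L, IsConcat (fun i => FreeMonoid.toList (φ (FreeMonoid.of (w i)))) x}

/-- Closure of a class of ω-languages under inverse images of morphisms. -/
def OmegaClass.ClosedUnderInverseImage (C : OmegaClass.{u}) : Prop :=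
  ∀ (A B : Type u) [Finite A] [Finite B] (φ : FreeMonoid A →* FreeMonoid B) (L : Set (ℕ → B)),
    L ∈ C B → omegaPreimage φ L ∈ C A

/-- `L₁` is `C`-separable from `L₂`. -/
def OmegaClass.Separable (C : OmegaClass.{u}) {A : Type u} [Finite A] (L₁ L₂ : Set (ℕ → A)) : Prop :=
  ∃ K ∈ C A, L₁ ⊆ K ∧ K ∩ L₂ = ∅

/-- The suffix languages: finite Boolean combinations of languages `A* x` with `x ∈ A*`. -/
def SU : LangClass.{u} := fun A _ =>
  BooleanSubalgebra.closure {K : Set (List A) | ∃ x : List A, K = {y | x <:+ y}}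

/-- The stratum `k` of the suffix languages: finite Boolean combinations of languages `A* x` with
`|x| ≤ k`. -/
def SUk (k : ℕ) : LangClass.{u} := fun A _ =>
  BooleanSubalgebra.closure {K : Set (List A) | ∃ x : List A, x.length ≤ k ∧ K = {y | x <:+ y}}

/-! ### Enrichment -/

/-- A finite partition of `A*` into languages of the class `D`. -/
structure DPartition (D : LangClass.{u}) (A : Type u) [Finite A] where
  /-- the finitely many parts -/
  parts : Finset (Set (List A))
  isPartition : Setoid.IsPartition (parts : Set (Set (List A)))
  mem_class : ∀ P ∈ parts, P ∈ D A

/-- The unique part containing the word `x`. -/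
noncomputable def DPartition.part {D : LangClass.{u}} {A : Type u} [Finite A] (P : DPartition D A)
    (x : List A) : P.parts :=
  ⟨(P.isPartition.2 x).choose, (P.isPartition.2 x).choose_spec.1.1⟩

/-- The tagging of an infinite word: every letter gets as an additional label the part that
contains the prefix strictly before it. -/
noncomputable def DPartition.tag {D : LangClass.{u}} {A : Type u} [Finite A] (P : DPartition D A)
    (w : ℕ → A) : ℕ → P.parts × A :=
  fun i => (P.part (pre w i), w i)

/-- The `D`-enrichment `C ∘ D` of a class `C` of ω-languages. -/
def enrichment (C : OmegaClass.{u}) (D : LangClass.{u}) : OmegaClass.{u} := fun A _ =>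
  {K | ∃ (P : DPartition D A) (L : Set (ℕ → P.parts × A)), L ∈ C (P.parts × A) ∧ K = P.tag ⁻¹' L}

/-! ### Well-formed ω-words -/

section WellFormed

variable {A : Type u} {S : Type u} {T : Type v} [Semigroup S] [OmegaSemigroup S T]

/-- The image `α(A⁺)`. -/
abbrev Img (α : OmegaHom (FreeSemigroup A) (ℕ → A) S T) : Type u :=
  {s : S // s ∈ Set.range α.fin}

/-- The set of idempotents of `α(A⁺)`. -/
abbrev Idem (α : OmegaHom (FreeSemigroup A) (ℕ → A) S T) : Type u :=
  {e : S // e ∈ Set.range α.fin ∧ e * e = e}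

/-- The alphabet of well-formed ω-words, `(E ∪ {□}) × α(A⁺) × E` where `E` is the set of idempotents
of `α(A⁺)`; the symbol `□` is `none`. -/
abbrev WFAlphabet (α : OmegaHom (FreeSemigroup A) (ℕ → A) S T) : Type u :=
  Option (Idem α) × Img α × Idem α

/-- Well-formed ω-words: `(□, s₀, e₁) (e₁, s₁, e₂) (e₂, s₂, e₃) ⋯`. -/
def WellFormed (α : OmegaHom (FreeSemigroup A) (ℕ → A) S T) (w : ℕ → WFAlphabet α) : Prop :=
  (w 0).1 = none ∧ ∀ i, (w (i + 1)).1 = some (w i).2.2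

/-- The evaluation of a letter: `(e, s, f) ↦ e s f` and `(□, s, f) ↦ s f`. -/
def wfLetter (α : OmegaHom (FreeSemigroup A) (ℕ → A) S T) : WFAlphabet α → S
  | (some e, s, f) => e.1 * s.1 * f.1
  | (none, s, f) => s.1 * f.1

/-- The canonical evaluation morphism on words over the alphabet of well-formed ω-words. -/
def wfEval (α : OmegaHom (FreeSemigroup A) (ℕ → A) S T) :
    OmegaHom (FreeSemigroup (WFAlphabet α)) (ℕ → WFAlphabet α) S T :=
  OmegaHom.lift (wfLetter α)

/-- The ω-language of well-formed ω-words associated to `L`. -/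
def wfLang (α : OmegaHom (FreeSemigroup A) (ℕ → A) S T) (L : Set (ℕ → A)) :
    Set (ℕ → WFAlphabet α) :=
  {w | WellFormed α w ∧ (wfEval α).inf w ∈ α.inf '' L}

end WellFormed

end OmegaSep

/-! Two letter-by-letter translations relate `ω`-words over `A` and well-formed words without
changing the value in `T`. Each becomes a morphism once suitable tags are available, so closure
under inverse image carries separators across.

From suffix tags to well-formed words (`exists_morphism_tag`): for a partition into suffix
languages, the part of a word depends only on its last `k` letters. Every idempotent `e` has a
preimage of length at least `k`, by pumping. The letter `(e, s, f)` is sent to preimages of `s` and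
`f`, tagged as if read after the chosen preimage of `e`. In a well-formed word this pretended
context agrees with the real one on `k` letters, so the tags are correct.

Back (`exists_isConcat_emit`, `emit_rtake`): let `N = 2 ^ (|S| + 1)`. By `exists_idempotent_factor`,
any `N` consecutive letters contain a nonempty factor with idempotent value. Mark each position
where such a factor of length at most `N` ends. At each mark, emit the idempotent of the previous
mark (or `□`), the value read since, and the new idempotent. Marks are at most `N` apart, so the
last `2N` letters determine what is emitted. The value survives because an idempotent that has just
been read may be repeated (`iprod_insertAt`). Finally `2N = 2 ^ (|S| + 2) ≤ 2 ^ (3|S| + 1)` when `S`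
is nonempty. -/

namespace OmegaSep

/-! ### Segment products in monoids and idempotent factors -/

section Segments

variable {M : Type*} [Monoid M]

/-- The product `f c * f (c+1) * ⋯ * f (d-1)`. -/
def iv (f : ℕ → M) (c d : ℕ) : M := ((List.range' c (d - c)).map f).prod

theorem iv_self (f : ℕ → M) (c : ℕ) : iv f c c = 1 := by simp [iv]

theorem iv_succ (f : ℕ → M) {c d : ℕ} (h : c ≤ d) : iv f c (d + 1) = iv f c d * f d := by
  rw [iv, iv, Nat.succ_sub h, Nat.succ_eq_add_one, List.range'_concat]
  simp [Nat.add_sub_cancel' h]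

theorem iv_mul (f : ℕ → M) {a b c : ℕ} (h : a ≤ b) (h' : b ≤ c) :
    iv f a b * iv f b c = iv f a c := by
  induction c, h' using Nat.le_induction with
  | base => rw [iv_self, mul_one]
  | succ c hc ih => rw [iv_succ f hc, iv_succ f (h.trans hc), ← mul_assoc, ih]

theorem iv_congr {f g : ℕ → M} {c d : ℕ} (h : ∀ i, c ≤ i → i < d → f i = g i) :
    iv f c d = iv g c d := by
  unfold iv
  congr 1
  apply List.map_congr_left
  intro i hi
  rw [List.mem_range'_1] at hi
  exact h i hi.1 (by omega)

/-- In a finite monoid, `y v = y` with `v` in the two-sided ideal of `y` makes `v` idempotent. -/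
theorem idempotent_of_mul_eq_self [Finite M] {y v a b : M} (h : y * v = y) (hv : v = a * y * b) :
    v * v = v := by
  -- Iterating this identity and comparing two equal powers of `a * y` removes the powers of `b`.
  -- Then `v` is a left multiple of `y`, and right multiplication by `v` fixes such elements.
  have hstep : v = (a * y) * v * b := by rw [mul_assoc a, h, ← hv]
  have hpow : ∀ n : ℕ, (a * y) ^ n * v * b ^ n = v := by
    intro n
    induction n with
    | zero => simp
    | succ n ih =>
      calc (a * y) ^ (n + 1) * v * b ^ (n + 1)
          = (a * y) ^ n * ((a * y) * v * b) * b ^ n := by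
            rw [pow_succ, pow_succ' b]; simp only [mul_assoc]
        _ = v := by rw [← hstep, ih]
  obtain ⟨i, j, hij, hc⟩ : ∃ i j : ℕ, i < j ∧ (a * y) ^ i = (a * y) ^ j := by
    obtain ⟨i, j, hne, hc⟩ := Finite.exists_ne_map_eq_of_infinite (fun n : ℕ => (a * y) ^ n)
    rcases lt_or_gt_of_ne hne with h | h
    · exact ⟨i, j, h, hc⟩
    · exact ⟨j, i, h, hc.symm⟩
  obtain ⟨d, rfl⟩ := Nat.exists_eq_add_of_lt hij
  have h1 : v = (a * y) ^ (d + 1) * v := by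
    calc v = (a * y) ^ (i + d + 1) * v * b ^ i := by rw [← hc, hpow]
      _ = (a * y) ^ (d + 1) * ((a * y) ^ i * v * b ^ i) := by
        rw [show i + d + 1 = (d + 1) + i by omega, pow_add]; simp only [mul_assoc]
      _ = _ := by rw [hpow]
  have h2 : v = (a * y) ^ d * a * y := by
    conv_lhs => rw [h1, pow_succ]
    rw [mul_assoc, mul_assoc a, h, ← mul_assoc]
  calc v * v = (a * y) ^ d * a * y * v := by rw [← h2]
    _ = v := by rw [mul_assoc _ y v, h, ← h2]

/-- The complement of `U` being an ideal, every segment of length `2 ^ |U|` contains a factor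
that is idempotent or outside `U`. -/
theorem exists_factor_idempotent_or_notMem [Finite M] (U : Finset M)
    (hU : ∀ x y a b : M, x ∈ U → x = a * y * b → y ∈ U) (f : ℕ → M) (c : ℕ) :
    ∃ a b, c ≤ a ∧ a < b ∧ b ≤ c + 2 ^ U.card ∧
      (iv f a b * iv f a b = iv f a b ∨ iv f a b ∉ U) := by
  classical
  induction hn : U.card using Nat.strong_induction_on generalizing U c with
  | _ n ih =>
  subst hn
  rcases U.eq_empty_or_nonempty with rfl | hne
  · exact ⟨c, c + 1, le_rfl, by omega, by simp, Or.inr (by simp)⟩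
  -- The `J`-order: `x ≤ y` when `y` is a factor of `x`. Thus `U` is an upper set, and removing the
  -- elements below a minimal `s` leaves a smaller upper set `U'`.
  let _ : Preorder M :=
    { le := fun x y => ∃ a b, x = a * y * b
      le_refl := fun x => ⟨1, 1, by simp⟩
      le_trans := by
        rintro x y z ⟨a, b, rfl⟩ ⟨a', b', rfl⟩
        exact ⟨a * a', b' * b, by simp only [mul_assoc]⟩ }
  obtain ⟨s, hs⟩ := U.exists_minimal hne
  set J := U.filter (fun x => x ≤ s) with hJ
  set U' := U.filter (fun x => ¬ x ≤ s) with hU'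
  have hcard : J.card + U'.card = U.card := Finset.card_filter_add_card_filter_not _
  have hJpos : 0 < J.card := Finset.card_pos.2 ⟨s, by simp [hJ, hs.prop]⟩
  have hup : ∀ x y a b : M, x ∈ U' → x = a * y * b → y ∈ U' := by
    intro x y a b hx hxy
    rw [hU', Finset.mem_filter] at hx ⊢
    exact ⟨hU x y a b hx.1 hxy, fun h => hx.2 (le_trans ⟨a, b, hxy⟩ h)⟩
  by_contra! hcon
  have hmemU : ∀ a b, c ≤ a → a < b → b ≤ c + 2 ^ U.card → iv f a b ∈ U := fun a b h1 h2 h3 =>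
    (hcon a b h1 h2 h3).2
  -- Without idempotents, induction puts a factor outside `U'` in every window of length `2 ^ |U'|`,
  -- so long segments fall into the bottom layer `J`.
  have hmem : ∀ a b, c ≤ a → a + 2 ^ U'.card ≤ b → b ≤ c + 2 ^ U.card → iv f a b ∈ J := by
    intro a b h1 h2 h3
    have hpos : 0 < 2 ^ U'.card := by positivity
    obtain ⟨a', b', ha, hab, hb, h⟩ := ih U'.card (by omega) U' hup a rfl
    have hnot : iv f a' b' ∉ U' :=
      h.resolve_left (hcon a' b' (by omega) hab (by omega)).1
    have h4 : iv f a b ∉ U' := fun hmem => hnot (hup _ _ (iv f a a') (iv f b' b) hmem (by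
      rw [iv_mul f ha hab.le, iv_mul f (by omega) (by omega)]))
    have h5 := hmemU a b h1 (by omega) h3
    rw [hU', Finset.mem_filter, not_and, not_not] at h4
    exact Finset.mem_filter.2 ⟨h5, h4 h5⟩
  have hle : ∀ j ∈ Finset.range (J.card + 1),
      c + (j + 1) * 2 ^ U'.card ≤ c + 2 ^ U.card := by
    intro j hj
    rw [Finset.mem_range] at hj
    have h1 : J.card + 1 ≤ 2 ^ J.card := Nat.lt_two_pow_self
    rw [← hcard, pow_add]
    exact Nat.add_le_add_left (Nat.mul_le_mul_right _ (by omega)) _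
  -- There is room for `|J| + 1` prefixes with values in `J`. Two of them share a value `y`, and the
  -- segment between them has a value `v ∈ J` with `y * v = y`.
  obtain ⟨i, hi, j, hj, hne', heq⟩ := Finset.exists_ne_map_eq_of_card_lt_of_maps_to
    (s := Finset.range (J.card + 1)) (t := J)
    (f := fun j => iv f c (c + (j + 1) * 2 ^ U'.card)) (by simp)
    (fun j hj => hmem _ _ le_rfl (by rw [Nat.succ_mul]; omega) (hle j hj))
  wlog hij : i < j generalizing i j
  · exact this j hj i hi hne'.symm heq.symm (by omega)
  obtain ⟨d, rfl⟩ := Nat.exists_eq_add_of_lt hij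
  have hv := hmem (c + (i + 1) * 2 ^ U'.card) (c + (i + d + 1 + 1) * 2 ^ U'.card) (by omega)
    (by
      rw [show i + d + 1 + 1 = (i + 1) + d + 1 by omega, Nat.succ_mul (i + 1 + d), Nat.add_mul (i + 1)]
      omega)
    (hle _ hj)
  have hy := hmem c (c + (i + 1) * 2 ^ U'.card) le_rfl (by rw [Nat.succ_mul]; omega) (hle _ hi)
  rw [hJ, Finset.mem_filter] at hv hy
  -- Minimality of `s` gives `v ≤ s ≤ y`, which is the ideal condition needed for idempotency.
  obtain ⟨a, b, hab⟩ := le_trans hv.2 (hs.le_of_le hy.1 hy.2)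
  refine (hcon _ _ (by omega) ?_ (hle _ hj)).1 (idempotent_of_mul_eq_self (y :=
    iv f c (c + (i + 1) * 2 ^ U'.card)) ?_ hab)
  · have : 0 < 2 ^ U'.card := by positivity
    have : (i + 1) * 2 ^ U'.card < (i + d + 1 + 1) * 2 ^ U'.card :=
      Nat.mul_lt_mul_of_pos_right (by omega) this
    omega
  · rw [iv_mul f (by omega)]
    · exact heq.symm
    · exact Nat.add_le_add_left (Nat.mul_le_mul_right _ (by omega)) _

/-- Every segment of length `2 ^ |M|` contains a nonempty factor with idempotent value. -/
theorem exists_idempotent_factor [Finite M] (f : ℕ → M) (c : ℕ) :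
    ∃ a b, c ≤ a ∧ a < b ∧ b ≤ c + 2 ^ Nat.card M ∧ iv f a b * iv f a b = iv f a b := by
  have := Fintype.ofFinite M
  obtain ⟨a, b, h1, h2, h3, h4⟩ :=
    exists_factor_idempotent_or_notMem Finset.univ (fun _ _ _ _ _ _ => Finset.mem_univ _) f c
  rw [Finset.card_univ, ← Nat.card_eq_fintype_card] at h3
  exact ⟨a, b, h1, h2, h3, h4.resolve_right (by simp)⟩

end Segments

/-! ### Infinite products -/

section InfiniteProducts

variable {S : Type u} {T : Type v} [Semigroup S] [OmegaSemigroup S T]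

/-- The product `f c * f (c+1) * ⋯ * f (d-1)`, in `S` with a neutral element adjoined. -/
def ivS (f : ℕ → S) (c d : ℕ) : WithOne S := iv (fun j => ((f j : S) : WithOne S)) c d

theorem ivS_self (f : ℕ → S) (c : ℕ) : ivS f c c = 1 := iv_self _ _

theorem ivS_succ (f : ℕ → S) {c d : ℕ} (h : c ≤ d) :
    ivS f c (d + 1) = ivS f c d * f d := iv_succ _ h

theorem ivS_mul (f : ℕ → S) {a b c : ℕ} (h : a ≤ b) (h' : b ≤ c) :
    ivS f a b * ivS f b c = ivS f a c := iv_mul _ h h'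

theorem coe_segProd (f : ℕ → S) (i d : ℕ) :
    ((segProd f i d : S) : WithOne S) = ivS f i (i + d + 1) := by
  induction d with
  | zero => rw [segProd, add_zero, ivS_succ _ le_rfl, ivS_self, one_mul]
  | succ d ih =>
    rw [segProd, WithOne.coe_mul, ih, ← Nat.add_assoc, ← ivS_succ _ (by omega)]

/-- The infinite product of the values of consecutive segments. -/
theorem iprod_eq_of_iv (f g : ℕ → S) (k : ℕ → ℕ) (hk : StrictMono k) (h0 : k 0 = 0)
    (h : ∀ n, ivS f (k n) (k (n + 1)) = g n) :
    (OmegaSemigroup.iprod g : T) = OmegaSemigroup.iprod f := by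
  rw [← OmegaSemigroup.iprod_regroup f k hk h0]
  congr 1
  funext n
  apply WithOne.coe_injective
  have := hk (Nat.lt_succ_self n)
  rw [← h, coe_segProd]
  congr 1
  simp only [Nat.succ_eq_add_one] at this
  omega

theorem iprod_congr_of_iv (f g : ℕ → S) (k : ℕ → ℕ) (hk : StrictMono k) (h0 : k 0 = 0)
    (h : ∀ n, ivS f (k n) (k (n + 1)) =
      ivS g (k n) (k (n + 1))) :
    (OmegaSemigroup.iprod f : T) = OmegaSemigroup.iprod g := by
  rw [← OmegaSemigroup.iprod_regroup f k hk h0]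
  apply iprod_eq_of_iv g _ k hk h0
  intro n
  have := hk (Nat.lt_succ_self n)
  rw [← h, coe_segProd]
  congr 1
  simp only [Nat.succ_eq_add_one] at this
  omega

/-- `(x₀y₀)(x₁y₁)⋯ = x₀ (y₀x₁)(y₁x₂)⋯`. -/
theorem iprod_slide (x y : ℕ → S) :
    (OmegaSemigroup.iprod (fun n => x n * y n) : T) =
      OmegaSemigroup.act (x 0) (OmegaSemigroup.iprod (fun n => y n * x (n + 1)) : T) := by
  have hmono : StrictMono (fun n : ℕ => 2 * n) := fun a b h => by simp only; omega
  -- Both sides are groupings of the same interleaved sequence `x₀ y₀ x₁ y₁ ⋯`.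
  have key : ∀ a b : ℕ → S, (OmegaSemigroup.iprod (fun n => a n * b n) : T) =
      OmegaSemigroup.iprod (fun n => if n % 2 = 0 then a (n / 2) else b (n / 2)) := by
    intro a b
    refine iprod_eq_of_iv _ _ (fun n => 2 * n) hmono rfl fun n => ?_
    rw [show 2 * (n + 1) = 2 * n + 1 + 1 by ring, ivS_succ _ (by omega), ivS_succ _ le_rfl, ivS_self,
      one_mul, WithOne.coe_mul]
    congr 2
    · simp
    · rw [if_neg (by omega)]
      congr 1
      omega
  rw [key, key, OmegaSemigroup.act_iprod]
  congr 1
  funext n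
  cases n with
  | zero => simp [consSeq]
  | succ n =>
    simp only [consSeq]
    rcases Nat.mod_two_eq_zero_or_one n with h | h
    · rw [if_neg (by omega), if_pos h]
      congr 1
      omega
    · rw [if_pos (by omega), if_neg (by omega)]
      congr 1
      omega

/-- Doubling the idempotents between consecutive factors does not change an infinite product. -/
theorem iprod_absorb (s e : ℕ → S) (he : ∀ n, e n * e n = e n) :
    (OmegaSemigroup.iprod (consSeq (s 0 * e 0) fun n => e n * s (n + 1) * e (n + 1)) : T) =
      OmegaSemigroup.iprod (fun n => s n * e n) := by
  -- After sliding, each doubled idempotent stands inside a single factor, where it collapses.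
  have h1 : (consSeq (s 0 * e 0) fun n => e n * s (n + 1) * e (n + 1)) =
      fun n => (consSeq (s 0) fun n => e n * s (n + 1)) n * e n := by
    funext n
    cases n <;> rfl
  rw [h1, iprod_slide, iprod_slide s e]
  simp only [consSeq, ← mul_assoc, he]

/-- The sequence `f` with the factor `e i` inserted after `f i` for each `i ∈ Q`. -/
noncomputable def insertAt (f e : ℕ → S) (Q : Set ℕ) (i : ℕ) : S :=
  open Classical in if i ∈ Q then f i * e i else f i

/-- Insertions inside `[s, d)` can be pushed to the left of the plain product. If the factor valued
`e i` starts after `s`, the idempotent is absorbed; otherwise the plain product up to `i` is itself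
a suffix of that factor, and the insertion joins `Y`. -/
theorem exists_iv_insertAt_eq_mul (f e : ℕ → S) (Q : Set ℕ) (b : ℕ → ℕ)
    (hb : ∀ i ∈ Q, b i ≤ i)
    (he : ∀ i ∈ Q, (e i : WithOne S) = ivS f (b i) (i + 1))
    (hidem : ∀ i ∈ Q, e i * e i = e i) {c s d : ℕ} (hcs : c ≤ s) (hsd : s ≤ d) :
    ∃ Y, ivS (insertAt f e Q) c d =
      Y * ivS f s d := by
  induction d, hsd using Nat.le_induction with
  | base => exact ⟨_, by rw [ivS_self, mul_one]⟩
  | succ d hsd ih =>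
    obtain ⟨Y, hY⟩ := ih
    rw [ivS_succ _ (hcs.trans hsd), hY]
    by_cases hd : d ∈ Q
    · have hidem' : (e d : WithOne S) * e d = e d := by rw [← WithOne.coe_mul, hidem d hd]
      rw [insertAt, if_pos hd, WithOne.coe_mul, ← mul_assoc, mul_assoc Y, ← ivS_succ _ hsd]
      rcases Nat.le_total s (b d) with h | h
      · refine ⟨Y, ?_⟩
        rw [← ivS_mul _ h ((hb d hd).trans d.le_succ), ← he d hd, mul_assoc, mul_assoc, hidem']
      · refine ⟨Y * ivS f s (d + 1) *
          ivS f (b d) s, ?_⟩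
        rw [he d hd, mul_assoc _ (ivS _ (b d) s), ivS_mul _ h (by omega)]
    · refine ⟨Y, ?_⟩
      rw [insertAt, if_neg hd, mul_assoc, ← ivS_succ _ hsd]

/-- An insertion whose idempotent factor lies entirely within the segment is redundant: by the
previous lemma the product read so far already ends in that idempotent, despite the earlier
insertions. -/
theorem iv_insertAt_congr (f e : ℕ → S) (Q Q' : Set ℕ) (hQ : Q' ⊆ Q) (b : ℕ → ℕ)
    (hb : ∀ i ∈ Q, b i ≤ i)
    (he : ∀ i ∈ Q, (e i : WithOne S) = ivS f (b i) (i + 1))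
    (hidem : ∀ i ∈ Q, e i * e i = e i) {c d : ℕ} (hcd : c ≤ d)
    (h : ∀ i ∈ Q, i ∉ Q' → c ≤ i → i < d → c ≤ b i) :
    ivS (insertAt f e Q) c d =
      ivS (insertAt f e Q') c d := by
  induction d, hcd using Nat.le_induction with
  | base => rw [ivS_self, ivS_self]
  | succ d hcd ih =>
    specialize ih fun i h1 h2 h3 h4 => h i h1 h2 h3 (by omega)
    by_cases hd : d ∈ Q ∧ d ∉ Q'
    · have hidem' : (e d : WithOne S) * e d = e d := by rw [← WithOne.coe_mul, hidem d hd.1]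
      obtain ⟨Y, hY⟩ := exists_iv_insertAt_eq_mul f e Q b hb he hidem
        (h d hd.1 hd.2 hcd d.lt_succ_self) (hb d hd.1)
      rw [ivS_succ _ hcd, ivS_succ _ hcd, ← ih, insertAt, if_pos hd.1, insertAt, if_neg hd.2, hY,
        WithOne.coe_mul, ← mul_assoc, mul_assoc Y, ← ivS_succ _ (hb d hd.1), ← he d hd.1, mul_assoc,
        hidem']
    · rw [ivS_succ _ hcd, ivS_succ _ hcd, ih]
      have hdQ : d ∈ Q ↔ d ∈ Q' := ⟨fun h1 => by_contra fun h2 => hd ⟨h1, h2⟩, fun h1 => hQ h1⟩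
      by_cases hd' : d ∈ Q'
      · rw [insertAt, insertAt, if_pos (hdQ.2 hd'), if_pos hd']
      · rw [insertAt, insertAt, if_neg (fun h => hd' (hdQ.1 h)), if_neg hd']

/-- Inserting after positions `i ∈ Q` idempotents which are values of factors of bounded length
ending there does not change an infinite product. -/
theorem iprod_insertAt (f e : ℕ → S) (Q : Set ℕ) (b : ℕ → ℕ) (N : ℕ)
    (hb : ∀ i ∈ Q, b i ≤ i) (hbN : ∀ i ∈ Q, i < b i + N)
    (he : ∀ i ∈ Q, (e i : WithOne S) = ivS f (b i) (i + 1))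
    (hidem : ∀ i ∈ Q, e i * e i = e i) :
    (OmegaSemigroup.iprod (insertAt f e Q) : T) = OmegaSemigroup.iprod f := by
  rcases Q.eq_empty_or_nonempty with rfl | ⟨i₀, hi₀⟩
  · congr 1
    funext i
    simp [insertAt]
  have hN : 0 < N := by
    have := hb i₀ hi₀
    have := hbN i₀ hi₀
    omega
  -- Only insertions whose factor does not straddle a cut can be removed, and no single regular
  -- cutting serves them all. With cuts at multiples of `2N`, those in the second half of a block
  -- can go. The cuts are then shifted by `N` for the others.
  set Q₁ : Set ℕ := {i ∈ Q | i % (2 * N) < N} with hQ₁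
  have hsub : Q₁ ⊆ Q := Set.sep_subset _ _
  have hf : f = insertAt f e ∅ := by
    funext i
    simp [insertAt]
  conv_rhs => rw [hf]
  trans (OmegaSemigroup.iprod (insertAt f e Q₁) : T)
  · refine iprod_congr_of_iv _ _ (fun n => 2 * N * n) (strictMono_nat_of_lt_succ fun n => ?_) rfl
      fun n => ?_
    · rw [Nat.mul_succ]
      omega
    · refine iv_insertAt_congr f e Q Q₁ hsub b hb he hidem (Nat.mul_le_mul_left _ n.le_succ)
        fun i hi hi' h1 h2 => ?_
      have h3 : ¬ i % (2 * N) < N := fun h => hi' ⟨hi, h⟩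
      have h4 : i / (2 * N) = n := by
        rw [Nat.div_eq_iff (by omega)]
        rw [Nat.mul_succ] at h2
        rw [mul_comm n]
        omega
      have h5 := Nat.div_add_mod i (2 * N)
      rw [h4] at h5
      have := hbN i hi
      omega
  -- Truncated subtraction makes the first cut `0`; the cuts are `0, N, 3N, 5N, …`.
  · refine iprod_congr_of_iv _ _ (fun n => 2 * N * n - N) (strictMono_nat_of_lt_succ fun n => ?_)
      (by simp) fun n => ?_
    · rw [Nat.mul_succ]
      omega
    · refine iv_insertAt_congr f e Q₁ ∅ (Set.empty_subset _) b (fun i hi => hb i hi.1)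
        (fun i hi => he i hi.1) (fun i hi => hidem i hi.1)
        (Nat.sub_le_sub_right (Nat.mul_le_mul_left _ n.le_succ) _)
        fun i hi _ h1 h2 => ?_
      have h3 : i % (2 * N) < N := hi.2
      have h4 := hbN i hi.1
      rw [Nat.mul_succ] at h2
      by_contra! h5
      have h6 : i < 2 * N * n := by omega
      have h7 : 0 < n := Nat.pos_of_ne_zero fun h => by simp [h] at h6
      obtain ⟨m, rfl⟩ := Nat.exists_eq_add_of_lt h7
      rw [zero_add, Nat.mul_succ] at h1 h5 h6
      have h8 : i / (2 * N) = m := by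
        rw [Nat.div_eq_iff (by omega)]
        rw [mul_comm m]
        omega
      have h9 := Nat.div_add_mod i (2 * N)
      rw [h8] at h9
      omega

end InfiniteProducts

/-! ### Evaluation of well-formed words -/

section Eval

variable {A : Type u} {S : Type u} {T : Type v} [Semigroup S] [OmegaSemigroup S T]

theorem wfEval_inf_eq (α : OmegaHom (FreeSemigroup A) (ℕ → A) S T) {w : ℕ → WFAlphabet α}
    (hw : WellFormed α w) :
    (wfEval α).inf w = OmegaSemigroup.iprod (fun n => (w n).2.1.1 * (w n).2.2.1) := by
  rw [← iprod_absorb _ _ fun n => (w n).2.2.2.2]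
  change OmegaSemigroup.iprod (fun i => wfLetter α (w i)) = _
  congr 1
  funext n
  cases n with
  | zero =>
    have := hw.1
    rcases h : w 0 with ⟨o, s, e⟩
    rw [h] at this
    obtain rfl : o = none := this
    rfl
  | succ n =>
    have := hw.2 n
    rcases h : w (n + 1) with ⟨o, s, e⟩
    rw [h] at this
    obtain rfl : o = some (w n).2.2 := this
    simp [wfLetter, consSeq, h]

theorem inf_eq_iprod (α : OmegaHom (FreeSemigroup A) (ℕ → A) S T) (u : ℕ → A) :
    α.inf u = OmegaSemigroup.iprod (fun n => α.fin (FreeSemigroup.of (u n))) := by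
  rw [← α.map_iprod]
  congr 1
  refine isConcat_unique (x := fun i => letters (FreeSemigroup.of (u i))) ⟨fun n => ?_, fun m =>
    ⟨m + 1, le_cat_letters _ (m + 1)⟩⟩ (isConcat_wordProd _)
  have : ∀ n, cat (fun i => letters (FreeSemigroup.of (u i))) n = pre u n := by
    intro n
    induction n with
    | zero => rfl
    | succ n ih => rw [cat_succ, ih, pre, pre, List.range_succ, List.map_append]; rfl
  rw [this, pre_length]

end Eval

/-! ### Suffixes of bounded length -/

theorem rtake_rtake {A : Type*} (x : List A) {m n : ℕ} (h : m ≤ n) :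
    (x.rtake n).rtake m = x.rtake m := by
  simp [List.rtake_eq_reverse_take_reverse, List.take_take, h]

theorem rtake_eq_self {A : Type*} {x : List A} {n : ℕ} (h : x.length ≤ n) : x.rtake n = x := by
  simp [List.rtake, h]

theorem rtake_append_of_le {A : Type*} (x y : List A) {n : ℕ} (h : n ≤ y.length) :
    (x ++ y).rtake n = y.rtake n := by
  rw [List.rtake_eq_reverse_take_reverse, List.rtake_eq_reverse_take_reverse, List.reverse_append,
    List.take_append_of_le_length (by simpa using h)]

theorem rtake_suffix {A : Type*} (x : List A) (n : ℕ) : x.rtake n <:+ x := List.drop_suffix _ _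

theorem length_rtake {A : Type*} (x : List A) (n : ℕ) : (x.rtake n).length = min n x.length := by
  simp [List.rtake]
  omega

theorem suffix_iff_rtake {A : Type*} {x y : List A} : x <:+ y ↔ y.rtake x.length = x := by
  constructor
  · rintro ⟨t, rfl⟩
    rw [rtake_append_of_le _ _ le_rfl, rtake_eq_self le_rfl]
  · intro h
    rw [← h]
    exact rtake_suffix _ _

theorem suffix_rtake_iff {A : Type*} {x y : List A} {n : ℕ} (h : x.length ≤ n) :
    x <:+ y.rtake n ↔ x <:+ y := by
  rw [suffix_iff_rtake, suffix_iff_rtake, rtake_rtake _ h]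

/-- Membership in a suffix language depends on a suffix of bounded length. -/
theorem exists_bound_of_mem_SU {A : Type u} [Finite A] {K : Set (List A)} (hK : K ∈ SU A) :
    ∃ k, ∀ x, x ∈ K ↔ x.rtake k ∈ K := by
  -- Asking for all `m ≥ k` lets the bounds of two languages be merged by `max`.
  have key : ∃ k, ∀ m, k ≤ m → ∀ x, x ∈ K ↔ x.rtake m ∈ K := by
    change K ∈ BooleanSubalgebra.closure _ at hK
    induction hK using BooleanSubalgebra.closure_bot_sup_induction with
    | mem K h =>
      obtain ⟨x, rfl⟩ := h
      exact ⟨x.length, fun m hm y => (suffix_rtake_iff hm).symm⟩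
    | bot => exact ⟨0, fun m _ x => Iff.rfl⟩
    | sup K _ L _ hK hL =>
      obtain ⟨k, hk⟩ := hK
      obtain ⟨l, hl⟩ := hL
      exact ⟨max k l, fun m hm x => or_congr (hk m (le_of_max_le_left hm) x)
        (hl m (le_of_max_le_right hm) x)⟩
    | compl K _ hK =>
      obtain ⟨k, hk⟩ := hK
      exact ⟨k, fun m hm x => not_congr (hk m hm x)⟩
  obtain ⟨k, hk⟩ := key
  exact ⟨k, hk k le_rfl⟩

namespace DPartition

variable {D : LangClass.{u}} {A : Type u} [Finite A]

theorem mem_part (P : DPartition D A) (x : List A) : x ∈ (P.part x).1 :=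
  (P.isPartition.2 x).choose_spec.1.2

theorem part_eq (P : DPartition D A) {x : List A} {Q : P.parts} (h : x ∈ Q.1) : P.part x = Q := by
  apply Subtype.ext
  exact ((P.isPartition.2 x).choose_spec.2 Q.1 ⟨Q.2, h⟩).symm

end DPartition

theorem DPartition.exists_part_rtake {A : Type u} [Finite A] (P : DPartition SU A) :
    ∃ k, ∀ x y, x.rtake k = y.rtake k → P.part x = P.part y := by
  have h : ∀ Q : P.parts, ∃ k, ∀ x, x ∈ Q.1 ↔ x.rtake k ∈ Q.1 := fun Q =>
    exists_bound_of_mem_SU (P.mem_class Q.1 Q.2)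
  choose k hk using h
  refine ⟨∑ Q, k Q, fun x y hxy => P.part_eq ?_⟩
  have hle : k (P.part y) ≤ ∑ Q, k Q := Finset.single_le_sum (f := k) (fun _ _ => Nat.zero_le _)
    (Finset.mem_univ (P.part y))
  rw [hk, ← rtake_rtake x hle, hxy, rtake_rtake y hle, ← hk]
  exact P.mem_part y

theorem pre_succ {A : Type*} (w : ℕ → A) (n : ℕ) : pre w (n + 1) = pre w n ++ [w n] := by
  rw [pre, pre, List.range_succ, List.map_append]
  rfl

/-! ### From a suffix enrichment to well-formed words -/

section Tagging

variable {D : LangClass.{u}} {A : Type u} [Finite A]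

/-- The tagging of the finite word `l` read after the finite word `c`. -/
noncomputable def DPartition.tagList (P : DPartition D A) : List A → List A → List (P.parts × A)
  | _, [] => []
  | c, a :: l => (P.part c, a) :: P.tagList (c ++ [a]) l

theorem DPartition.tagList_append (P : DPartition D A) (c l l' : List A) :
    P.tagList c (l ++ l') = P.tagList c l ++ P.tagList (c ++ l) l' := by
  induction l generalizing c with
  | nil => simp [tagList]
  | cons a l ih => simp [tagList, ih]

theorem DPartition.length_tagList (P : DPartition D A) (c l : List A) :
    (P.tagList c l).length = l.length := by
  induction l generalizing c with
  | nil => rfl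
  | cons a l ih => simp [tagList, ih]

theorem DPartition.tagList_pre (P : DPartition D A) (w : ℕ → A) (n : ℕ) :
    P.tagList [] (pre w n) = pre (P.tag w) n := by
  induction n with
  | zero => rfl
  | succ n ih => rw [pre_succ, tagList_append, ih, pre_succ]; rfl

theorem DPartition.tagList_append_context (P : DPartition D A) {k : ℕ}
    (hk : ∀ x y, x.rtake k = y.rtake k → P.part x = P.part y) (c q l : List A)
    (hq : k ≤ q.length) : P.tagList (c ++ q) l = P.tagList q l := by
  induction l generalizing q with
  | nil => rfl
  | cons a l ih =>
    rw [tagList, tagList, List.append_assoc, ih (q ++ [a]) (by simp; omega),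
      hk _ _ (rtake_append_of_le c q hq)]

end Tagging

/-- Powers of one preimage of an idempotent are again preimages. They supply contexts long enough to
determine the part. -/
theorem exists_long_preimage {A : Type u} {S : Type v} [Semigroup S] (f : FreeSemigroup A →ₙ* S)
    {e : S} (he : e ∈ Set.range f) (hidem : e * e = e) (k : ℕ) :
    ∃ x, f x = e ∧ k ≤ (letters x).length := by
  obtain ⟨v, rfl⟩ := he
  induction k with
  | zero => exact ⟨v, rfl, Nat.zero_le _⟩
  | succ k ih =>
    obtain ⟨x, hx, hk⟩ := ih
    refine ⟨x * v, by rw [map_mul, hx, hidem], ?_⟩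
    rw [letters_mul, List.length_append]
    simp only [letters, List.length_cons] at hk ⊢
    omega

theorem mem_omegaPreimage_iff {A B : Type u} {φ : FreeMonoid A →* FreeMonoid B} {L : Set (ℕ → B)}
    {w : ℕ → A} {x : ℕ → B}
    (h : IsConcat (fun i => FreeMonoid.toList (φ (FreeMonoid.of (w i)))) x) :
    w ∈ omegaPreimage φ L ↔ x ∈ L :=
  ⟨fun ⟨_, hy, hc⟩ => isConcat_unique hc h ▸ hy, fun hx => ⟨x, hx, h⟩⟩

section

variable {A : Type u} [Finite A] {S : Type u} {T : Type v} [Semigroup S] [OmegaSemigroup S T]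

/-- For a partition into suffix languages, some morphism sends every well-formed word to the
tagging of a word with the same value. -/
theorem exists_morphism_tag (α : OmegaHom (FreeSemigroup A) (ℕ → A) S T) (P : DPartition SU A) :
    ∃ φ : FreeMonoid (WFAlphabet α) →* FreeMonoid (P.parts × A),
      ∀ w, WellFormed α w → ∃ u, α.inf u = (wfEval α).inf w ∧
        IsConcat (fun i => FreeMonoid.toList (φ (FreeMonoid.of (w i)))) (P.tag u) := by
  obtain ⟨k, hk⟩ := P.exists_part_rtake
  have hs : ∀ s : Img α, ∃ x, α.fin x = s.1 := fun s => s.2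
  choose ws hws using hs
  choose we hwe hlen using fun e : Idem α => exists_long_preimage α.fin e.2.1 e.2.2 k
  -- The symbol `□` occurs only at the start of a well-formed word, where the context really is
  -- empty.
  let ctx : Option (Idem α) → List A := fun o => o.elim [] (fun e => letters (we e))
  refine ⟨FreeMonoid.lift fun l =>
    FreeMonoid.ofList (P.tagList (ctx l.1) (letters (ws l.2.1 * we l.2.2))), fun w hw => ?_⟩
  set f : ℕ → FreeSemigroup A := fun n => ws (w n).2.1 * we (w n).2.2 with hf
  have hu := isConcat_wordProd f
  refine ⟨wordProd f, ?_, ?_⟩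
  · rw [wfEval_inf_eq α hw]
    refine (α.map_iprod f).trans ?_
    congr 1
    funext n
    rw [hf, map_mul, hws, hwe]
  · have hctx : ∀ n, P.tagList (ctx (w n).1) (letters (f n)) =
        P.tagList (cat (fun i => letters (f i)) n) (letters (f n)) := by
      intro n
      cases n with
      | zero => rw [hw.1]; rfl
      | succ n =>
        rw [hw.2, cat_succ]
        simp only [hf]
        rw [letters_mul (ws (w n).2.1), ← List.append_assoc,
          P.tagList_append_context hk _ _ _ (hlen _)]
        rfl
    have hcat : ∀ n, cat (fun i => P.tagList (ctx (w i).1) (letters (f i))) n =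
        P.tagList [] (cat (fun i => letters (f i)) n) := by
      intro n
      induction n with
      | zero => rfl
      | succ n ih => rw [cat_succ, ih, cat_succ, P.tagList_append, List.nil_append, hctx]
    simp only [FreeMonoid.lift_eval_of, FreeMonoid.toList_ofList]
    constructor
    · intro n
      change cat (fun i => P.tagList (ctx (w i).1) (letters (f i))) n = pre _
        (cat (fun i => P.tagList (ctx (w i).1) (letters (f i))) n).length
      rw [hcat, P.length_tagList, ← P.tagList_pre, ← hu.1]
    · intro m
      obtain ⟨n, hn⟩ := hu.2 m
      refine ⟨n, ?_⟩
      change m < (cat (fun i => P.tagList (ctx (w i).1) (letters (f i))) n).length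
      rwa [hcat, P.length_tagList]

omit [Finite A] in
-- The word built from a well-formed word shares only its value with a member of `L`; recognition
-- makes that suffice.
theorem OmegaHom.Recognizes.mem_of_inf_mem {α : OmegaHom (FreeSemigroup A) (ℕ → A) S T}
    {L : Set (ℕ → A)} (h : α.Recognizes L) {u : ℕ → A} (hu : α.inf u ∈ α.inf '' L) : u ∈ L := by
  obtain ⟨F, rfl⟩ := h
  obtain ⟨u', hu', he⟩ := hu
  rw [Set.mem_preimage, ← he]
  exact hu'

theorem separable_wfLang_of_enrichment {α : OmegaHom (FreeSemigroup A) (ℕ → A) S T} [Finite S]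
    {C : OmegaClass.{u}} (hinv : C.ClosedUnderInverseImage) {L₁ L₂ : Set (ℕ → A)}
    (h₁ : α.Recognizes L₁) (h₂ : α.Recognizes L₂) (h : (enrichment C SU).Separable L₁ L₂) :
    C.Separable (wfLang α L₁) (wfLang α L₂) := by
  obtain ⟨_, ⟨P, L, hL, rfl⟩, hsub, hdisj⟩ := h
  obtain ⟨φ, hφ⟩ := exists_morphism_tag α P
  refine ⟨omegaPreimage φ L, hinv _ _ φ L hL, fun w hw => ?_, Set.eq_empty_of_forall_notMem ?_⟩
  · obtain ⟨u, hu, hc⟩ := hφ w hw.1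
    have := hw.2
    rw [← hu] at this
    exact (mem_omegaPreimage_iff hc).2 (hsub (h₁.mem_of_inf_mem this))
  · rintro w ⟨hw, hw'⟩
    obtain ⟨u, hu, hc⟩ := hφ w hw'.1
    have := hw'.2
    rw [← hu] at this
    have hmem : u ∈ P.tag ⁻¹' L ∩ L₂ :=
      ⟨(mem_omegaPreimage_iff hc).1 hw, h₂.mem_of_inf_mem this⟩
    rw [hdisj] at hmem
    exact hmem

end

/-! ### Finite prefixes and factors of infinite words -/

/-- The factor `w c ⋯ w (d-1)` of the infinite word `w`. -/
def slice {A : Type*} (w : ℕ → A) (c d : ℕ) : List A := (List.range (d - c)).map fun j => w (c + j)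

theorem rtake_pre {A : Type*} (w : ℕ → A) (p t : ℕ) : (pre w p).rtake t = slice w (p - t) p := by
  apply List.ext_getElem?
  intro i
  simp only [List.rtake, pre, slice, List.length_map, List.length_range, List.getElem?_drop,
    List.getElem?_map]
  by_cases h : i < p - (p - t)
  · rw [List.getElem?_range h, List.getElem?_range (by omega)]
    rfl
  · rw [List.getElem?_eq_none (by simp; omega), List.getElem?_eq_none (by simp; omega)]
    rfl

theorem rdrop_pre {A : Type*} (w : ℕ → A) (p t : ℕ) : (pre w p).rdrop t = pre w (p - t) := by
  rw [List.rdrop, pre_length, pre, ← List.map_take, List.take_range, pre,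
    min_eq_left (Nat.sub_le _ _)]

theorem rdrop_rtake {A : Type*} (x : List A) (m t : ℕ) :
    (x.rtake m).rdrop t = (x.rdrop t).rtake (m - t) := by
  simp [List.rtake_eq_reverse_take_reverse, List.rdrop_eq_reverse_drop_reverse, List.drop_take]

/-- A list as an element of the free semigroup (with an arbitrary value on the empty list). -/
def wordOf {A : Type u} [Inhabited A] (x : List A) : FreeSemigroup A := ⟨x.headI, x.tail⟩

section

variable {A : Type u} {S : Type u} {T : Type v} [Semigroup S] [OmegaSemigroup S T]

theorem fin_wordOf_slice [Inhabited A] (α : OmegaHom (FreeSemigroup A) (ℕ → A) S T) (w : ℕ → A)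
    {c d : ℕ} (h : c < d) :
    ((α.fin (wordOf (slice w c d)) : S) : WithOne S) =
      ivS (fun i => α.fin (FreeSemigroup.of (w i))) c d := by
  obtain ⟨k, rfl⟩ := Nat.exists_eq_add_of_lt h
  have hα : α.fin = FreeSemigroup.lift (fun a => α.fin (FreeSemigroup.of a)) :=
    FreeSemigroup.hom_ext (by funext a; simp)
  have hl : letters (wordOf (slice w c (c + k + 1))) =
      (List.range (k + 1)).map (fun j => w (c + j)) := by
    rw [slice, show c + k + 1 - c = k + 1 by omega, List.range_succ_eq_map]
    rfl
  rw [hα, lift_eq_segProd _ w c k _ hl, coe_segProd, ← hα]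

end

/-! ### Marked prefixes and the emission of letters -/

section Marks

variable {A : Type u} [Inhabited A] {S : Type u} {T : Type v} [Semigroup S] [OmegaSemigroup S T]
  (α : OmegaHom (FreeSemigroup A) (ℕ → A) S T)

/-- The image of a nonempty finite word. -/
def img (x : List A) : Img α := ⟨α.fin (wordOf x), _, rfl⟩

/-- The idempotent `e` is the value of a nonempty suffix of `x`. -/
def IsSuffixValue (x : List A) (e : Idem α) : Prop :=
  ∃ t, 0 < t ∧ t ≤ x.length ∧ α.fin (wordOf (x.rtake t)) = e.1

/-- Some nonempty suffix of `x` of length at most `N` has an idempotent value. -/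
def Marked (N : ℕ) (x : List A) : Prop := ∃ e : Idem α, IsSuffixValue α (x.rtake N) e

/-- An idempotent value of a suffix of length at most `N`, depending only on the suffix of
length `N`. -/
noncomputable def mark [Nonempty (Idem α)] (N : ℕ) (x : List A) : Idem α :=
  Classical.epsilon (IsSuffixValue α (x.rtake N))

/-- The distances, at most `N`, from the end of `x` to the ends of its proper marked prefixes. -/
def gaps (N : ℕ) (x : List A) : Set ℕ := {t | 0 < t ∧ t ≤ N ∧ Marked α N (x.rdrop t)}

/-- The letters of the well-formed word emitted after reading the prefix `x`. -/
noncomputable def emit [Nonempty (Idem α)] (N : ℕ) (x : List A) : List (WFAlphabet α) :=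
  open Classical in
  if Marked α N x then
    if (gaps α N x).Nonempty then
      [(some (mark α N (x.rdrop (sInf (gaps α N x)))), img α (x.rtake (sInf (gaps α N x))),
        mark α N x)]
    else [(none, img α x, mark α N x)]
  else []

variable {α}

theorem marked_congr {N : ℕ} {x y : List A} (h : x.rtake N = y.rtake N) :
    Marked α N x ↔ Marked α N y := by
  rw [Marked, Marked, h]

theorem mark_congr [Nonempty (Idem α)] {N : ℕ} {x y : List A} (h : x.rtake N = y.rtake N) :
    mark α N x = mark α N y := by
  rw [mark, mark, h]

theorem not_marked_nil (N : ℕ) : ¬ Marked α N [] := by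
  rintro ⟨e, t, h0, h1, -⟩
  simp at h1
  omega

-- The idempotent found in `S` with a unit adjoined lies in `α(A⁺)` because the factor is nonempty.
variable (α) in
theorem exists_marked [Finite S] (u : ℕ → A) (c : ℕ) :
    ∃ p, c < p ∧ p ≤ c + 2 ^ Nat.card (WithOne S) ∧
      Marked α (2 ^ Nat.card (WithOne S)) (pre u p) := by
  have : Finite (WithOne S) := inferInstanceAs (Finite (Option S))
  obtain ⟨a, b, h1, h2, h3, h4⟩ := exists_idempotent_factor
    (fun i => ((α.fin (FreeSemigroup.of (u i)) : S) : WithOne S)) c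
  change ivS (fun i => α.fin (FreeSemigroup.of (u i))) a b *
    ivS (fun i => α.fin (FreeSemigroup.of (u i))) a b =
    ivS (fun i => α.fin (FreeSemigroup.of (u i))) a b at h4
  rw [← fin_wordOf_slice α u h2, ← WithOne.coe_mul, WithOne.coe_inj] at h4
  refine ⟨b, by omega, h3, ⟨_, ⟨_, rfl⟩, h4⟩, b - a, by omega, ?_, ?_⟩
  · rw [length_rtake, pre_length]
    omega
  · rw [rtake_rtake _ (by omega), rtake_pre, show b - (b - a) = a by omega]

theorem exists_mark_eq [Nonempty (Idem α)] {N : ℕ} {u : ℕ → A} {p : ℕ}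
    (h : Marked α N (pre u p)) :
    ∃ b, b < p ∧ p ≤ b + N ∧ (((mark α N (pre u p)).1 : S) : WithOne S) =
      ivS (fun i => α.fin (FreeSemigroup.of (u i))) b p := by
  obtain ⟨t, h0, h1, h2⟩ := Classical.epsilon_spec h
  rw [length_rtake, pre_length] at h1
  refine ⟨p - t, by omega, by omega, ?_⟩
  rw [rtake_rtake _ (by omega), rtake_pre] at h2
  rw [← fin_wordOf_slice α u (by omega), h2]
  rfl

/-- The previous mark is at most `N` letters back and its idempotent depends on `N` letters before
it, so `2N` letters suffice. -/
theorem emit_rtake [Finite S] [Nonempty (Idem α)] {m : ℕ} (hm : 2 * 2 ^ Nat.card (WithOne S) ≤ m)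
    (u : ℕ → A) (p : ℕ) :
    emit α (2 ^ Nat.card (WithOne S)) ((pre u p).rtake m) =
      emit α (2 ^ Nat.card (WithOne S)) (pre u p) := by
  rcases Nat.le_total p m with hp | hp
  · rw [rtake_eq_self (by rwa [pre_length])]
  -- An earlier mark within distance `N` excludes the `□` branch, the only one that reads the whole
  -- prefix.
  obtain ⟨q, hq, hq', hmark⟩ := exists_marked α u (p - 1 - 2 ^ Nat.card (WithOne S))
  have hN : 0 < 2 ^ Nat.card (WithOne S) := by positivity
  set N := 2 ^ Nat.card (WithOne S)
  set x := pre u p with hx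
  have hloc : ∀ t ≤ N, ((x.rtake m).rdrop t).rtake N = (x.rdrop t).rtake N := by
    intro t ht
    rw [rdrop_rtake, rtake_rtake _ (by omega)]
  have hgaps : gaps α N (x.rtake m) = gaps α N x := by
    ext t
    refine and_congr_right fun _ => and_congr_right fun ht => marked_congr (hloc t ht)
  have hne : (gaps α N x).Nonempty := by
    refine ⟨p - q, by omega, by omega, ?_⟩
    rwa [hx, rdrop_pre, show p - (p - q) = q by omega]
  have hle : sInf (gaps α N x) ≤ N := (Nat.sInf_mem hne).2.1
  have h0 : (x.rtake m).rtake N = x.rtake N := rtake_rtake x (by omega)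
  rw [emit, emit, hgaps, if_pos hne, if_pos hne, mark_congr (hloc _ hle), mark_congr h0,
    rtake_rtake x (by omega)]
  by_cases hM : Marked α N x
  · rw [if_pos hM, if_pos ((marked_congr h0).2 hM)]
  · rw [if_neg hM, if_neg fun h => hM ((marked_congr h0).1 h)]

variable (α) in
/-- The emitted letters form a well-formed word with the same value. -/
theorem exists_isConcat_emit [Finite S] [Nonempty (Idem α)] (u : ℕ → A) :
    ∃ w, WellFormed α w ∧ (wfEval α).inf w = α.inf u ∧
      IsConcat (fun i => emit α (2 ^ Nat.card (WithOne S)) (pre u (i + 1))) w := by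
  classical
  have hmk := exists_marked α u
  have hN : 0 < 2 ^ Nat.card (WithOne S) := by positivity
  set N := 2 ^ Nat.card (WithOne S)
  set D : ℕ → Prop := fun i => Marked α N (pre u (i + 1)) with hD
  have hnext : ∀ c, ∃ i, D i ∧ c ≤ i ∧ i < c + N := by
    intro c
    obtain ⟨p, h1, h2, h3⟩ := hmk c
    refine ⟨p - 1, ?_, by omega, by omega⟩
    change Marked α N (pre u (p - 1 + 1))
    rwa [Nat.sub_add_cancel (by omega)]
  have hinf : (Set.ofPred D).Infinite := by
    refine Set.infinite_of_forall_exists_gt fun c => ?_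
    obtain ⟨i, h1, h2, -⟩ := hnext (c + 1)
    exact ⟨i, h1, h2⟩
  set q := Nat.nth D with hq
  have hqD : ∀ j, D (q j) := Nat.nth_mem_of_infinite hinf
  have hmono : StrictMono q := Nat.nth_strictMono hinf
  have hcount : ∀ i, D i → ∃ j, q j = i := fun i hi => ⟨Nat.count D i, Nat.nth_count hi⟩
  -- The `j`-th emitted letter accounts for the segment from `c j` to `q j` inclusive.
  let c : ℕ → ℕ := consSeq 0 fun j => q j + 1
  have hc : ∀ j, c j ≤ q j := by
    intro j
    cases j with
    | zero => exact Nat.zero_le _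
    | succ j => exact hmono j.lt_succ_self
  have hcD : ∀ j i, c j ≤ i → i < q j → ¬ D i := by
    intro j i h1 h2 hi
    obtain ⟨k, rfl⟩ := hcount i hi
    have hk := hmono.lt_iff_lt.1 h2
    cases j with
    | zero => omega
    | succ j =>
      have h1' : q j + 1 ≤ q k := h1
      have := hmono.lt_iff_lt.1 h1'
      omega
  have hcgap : ∀ j, q j < c j + N := by
    intro j
    obtain ⟨i, h1, h2, h3⟩ := hnext (c j)
    by_contra! h
    exact hcD j i h2 (by omega) h1
  let w : ℕ → WFAlphabet α := fun j =>
    (consSeq none (fun k => some (mark α N (pre u (q k + 1)))) j,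
      img α (slice u (c j) (q j + 1)), mark α N (pre u (q j + 1)))
  have hw : WellFormed α w := ⟨rfl, fun j => rfl⟩
  have hemit : ∀ j, emit α N (pre u (q j + 1)) = [w j] := by
    intro j
    rw [emit, if_pos (hqD j)]
    have hgap : ∀ t ∈ gaps α N (pre u (q j + 1)), ∃ i, D i ∧ i + t = q j := by
      rintro t ⟨h1, h2, h3⟩
      rw [rdrop_pre] at h3
      have h4 : 0 < q j + 1 - t := by
        refine Nat.pos_of_ne_zero fun h => not_marked_nil (α := α) N ?_
        rwa [h] at h3
      refine ⟨q j - t, ?_, by omega⟩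
      change Marked α N (pre u (q j - t + 1))
      rwa [show q j - t + 1 = q j + 1 - t by omega]
    cases j with
    | zero =>
      rw [if_neg]
      · change [_] = [(none, img α (slice u 0 (q 0 + 1)), _)]
        have hpre := rtake_pre u (q 0 + 1) (q 0 + 1)
        rw [Nat.sub_self, rtake_eq_self (by rw [pre_length])] at hpre
        rw [← hpre]
      · rintro ⟨t, ht⟩
        obtain ⟨i, hi, hit⟩ := hgap t ht
        have := ht.1
        exact hcD 0 i (Nat.zero_le _) (by omega) hi
    | succ j =>
      have hlt := hmono j.lt_succ_self
      simp only [Nat.succ_eq_add_one] at hlt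
      have hleast : IsLeast (gaps α N (pre u (q (j + 1) + 1))) (q (j + 1) - q j) := by
        constructor
        · have hg : q (j + 1) < q j + 1 + N := hcgap (j + 1)
          refine ⟨by omega, by omega, ?_⟩
          rw [rdrop_pre, show q (j + 1) + 1 - (q (j + 1) - q j) = q j + 1 by omega]
          exact hqD j
        · intro t ht
          obtain ⟨i, hi, hit⟩ := hgap t ht
          have := ht.1
          by_contra! h
          exact hcD (j + 1) i (by change q j + 1 ≤ i; omega) (by omega) hi
      rw [if_pos ⟨_, hleast.1⟩, hleast.csInf_eq, rdrop_pre, rtake_pre,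
        show q (j + 1) + 1 - (q (j + 1) - q j) = q j + 1 by omega]
      rfl
  refine ⟨w, hw, ?_, ?_⟩
  · have hb : ∀ i, ∃ b, D i → b < i + 1 ∧ i + 1 ≤ b + N ∧
        (((mark α N (pre u (i + 1))).1 : S) : WithOne S) =
          ivS (fun i => α.fin (FreeSemigroup.of (u i))) b (i + 1) := by
      intro i
      by_cases hi : D i
      · obtain ⟨b, h⟩ := exists_mark_eq hi
        exact ⟨b, fun _ => h⟩
      · exact ⟨0, fun h => absurd h hi⟩
    -- Inserting the mark idempotents leaves the value of `u` unchanged; cutting right after each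
    -- mark then yields the factors of `wfEval_inf_eq`.
    choose b hb using hb
    rw [wfEval_inf_eq α hw, inf_eq_iprod α u,
      ← iprod_insertAt _ (fun i => (mark α N (pre u (i + 1))).1) {i | D i} b N
        (fun i hi => Nat.le_of_lt_succ (hb i hi).1) (fun i hi => (hb i hi).2.1)
        (fun i hi => (hb i hi).2.2) (fun i _ => (mark α N (pre u (i + 1))).2.2)]
    refine iprod_eq_of_iv _ _ c (strictMono_nat_of_lt_succ fun j => Nat.lt_succ_of_le (hc j)) rfl
      fun j => ?_
    change ivS _ (c j) (q j + 1) = _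
    rw [ivS_succ _ (hc j), insertAt, if_pos (show q j ∈ {i | D i} from hqD j), WithOne.coe_mul,
      ← mul_assoc, WithOne.coe_mul]
    congr 1
    change _ = ((α.fin (wordOf (slice u (c j) (q j + 1))) : S) : WithOne S)
    rw [fin_wordOf_slice α u (Nat.lt_succ_of_le (hc j)), ivS_succ _ (hc j)]
    congr 1
    refine iv_congr fun i h1 h2 => ?_
    rw [insertAt, if_neg (show i ∉ {i | D i} from hcD j i h1 h2)]
  · have hcat : ∀ n, cat (fun i => emit α N (pre u (i + 1))) n = pre w (Nat.count D n) := by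
      intro n
      induction n with
      | zero => rw [Nat.count_zero]; rfl
      | succ n ih =>
        rw [cat_succ, ih, Nat.count_succ]
        by_cases hn : D n
        · have hn' : q (Nat.count D n) = n := Nat.nth_count hn
          rw [if_pos hn, pre_succ w, ← hemit, hn']
        · rw [if_neg hn, emit, if_neg hn, List.append_nil, add_zero]
    refine ⟨fun n => by rw [hcat, pre_length], fun m => ⟨q m + 1, ?_⟩⟩
    rw [hcat, pre_length, Nat.count_succ, if_pos (hqD m), Nat.count_nth_of_infinite hinf]
    exact m.lt_succ_self

end Marks

/-! ### The partition according to suffixes of bounded length -/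

/-- For `|y| = n` this is the generator `A* y`. For shorter `y` it is the singleton `{y}`, namely
`A* y` minus all `A* a y`, whose suffixes still have length at most `n`. -/
theorem setOf_rtake_eq_mem_SUk {A : Type u} [Finite A] {n : ℕ} {y : List A} (hy : y.length ≤ n) :
    {x : List A | x.rtake n = y} ∈ SUk n A := by
  have hgen : ∀ z : List A, z.length ≤ n → {x : List A | z <:+ x} ∈ BooleanSubalgebra.closure
      {K : Set (List A) | ∃ x : List A, x.length ≤ n ∧ K = {y | x <:+ y}} := fun z hz =>
    BooleanSubalgebra.subset_closure ⟨z, hz, rfl⟩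
  change _ ∈ BooleanSubalgebra.closure _
  rcases hy.eq_or_lt with rfl | hlt
  · convert hgen y le_rfl using 1
    ext x
    exact suffix_iff_rtake.symm
  · have := Fintype.ofFinite A
    have hsup := Finset.sup_mem (BooleanSubalgebra.closure
      {K : Set (List A) | ∃ x : List A, x.length ≤ n ∧ K = {y | x <:+ y}} : Set (Set (List A)))
      BooleanSubalgebra.bot_mem (fun _ h _ h' => BooleanSubalgebra.sup_mem h h')
      (Finset.univ : Finset A) (fun a => {x : List A | a :: y <:+ x})
      (fun a _ => hgen (a :: y) (by simpa using hlt))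
    convert BooleanSubalgebra.sdiff_mem (hgen y hy) hsup using 1
    ext x
    simp only [Finset.sup_univ_eq_iSup, Set.iSup_eq_iUnion, Set.mem_sdiff, Set.mem_ofPred_eq,
      Set.mem_iUnion, not_exists]
    constructor
    · rintro rfl
      rw [length_rtake] at hlt
      rw [rtake_eq_self (by omega)]
      exact ⟨List.suffix_rfl, fun a h => by simpa using h.length_le⟩
    · rintro ⟨⟨t, rfl⟩, h⟩
      rcases t.eq_nil_or_concat with rfl | ⟨t, a, rfl⟩
      · exact rtake_eq_self hy
      · exact absurd ⟨t, by simp⟩ (h a)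

theorem exists_partition_rtake (A : Type u) [Finite A] (n : ℕ) :
    ∃ (P : DPartition (SUk n) A) (r : P.parts → List A), ∀ x, r (P.part x) = x.rtake n := by
  have hfin : ((fun y : List A => {x : List A | x.rtake n = y}) ''
      {y : List A | y.length ≤ n}).Finite := (List.finite_length_le A n).image _
  have hex : ∀ Q ∈ hfin.toFinset, ∃ y : List A, y.length ≤ n ∧ {x : List A | x.rtake n = y} = Q :=
    fun Q hQ => (hfin.mem_toFinset).1 hQ
  let P : DPartition (SUk n) A :=
    { parts := hfin.toFinset
      isPartition := by
        constructor
        · intro h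
          obtain ⟨y, hy, he⟩ := hex ∅ h
          exact (he ▸ Set.notMem_empty y : y ∉ {x : List A | x.rtake n = y}) (rtake_eq_self hy)
        · intro x
          refine ⟨{z | z.rtake n = x.rtake n}, ⟨?_, rfl⟩, ?_⟩
          · exact (hfin.mem_toFinset).2 ⟨x.rtake n, by simp [length_rtake], rfl⟩
          · rintro Q ⟨hQ, hx⟩
            obtain ⟨y, hy, rfl⟩ := hex Q hQ
            rw [show x.rtake n = y from hx]
      mem_class := by
        intro Q hQ
        obtain ⟨y, hy, rfl⟩ := hex Q hQ
        exact setOf_rtake_eq_mem_SUk hy }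
  choose r hr using fun Q : P.parts => hex Q.1 Q.2
  refine ⟨P, r, fun x => ?_⟩
  have := P.mem_part x
  rw [← (hr (P.part x)).2] at this
  exact this.symm

/-- The bound involves `n + 1` because a tag gives `n` letters of the prefix and the current letter
adds one. The word `u₀` only ensures that letters and idempotents exist. -/
theorem separable_enrichment_of_wfLang {A : Type u} [Finite A] {S : Type u} {T : Type v}
    [Semigroup S] [Finite S] [OmegaSemigroup S T]
    {α : OmegaHom (FreeSemigroup A) (ℕ → A) S T} {C : OmegaClass.{u}}
    (hinv : C.ClosedUnderInverseImage) {L₁ L₂ : Set (ℕ → A)}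
    {n : ℕ} (hn : 2 * 2 ^ Nat.card (WithOne S) ≤ n + 1)
    (h : C.Separable (wfLang α L₁) (wfLang α L₂)) (u₀ : ℕ → A) :
    (enrichment C (SUk n)).Separable L₁ L₂ := by
  obtain ⟨K, hK, hsub, hdisj⟩ := h
  obtain ⟨P, r, hr⟩ := exists_partition_rtake A n
  have : Inhabited A := ⟨u₀ 0⟩
  have : Nonempty (Idem α) := by
    obtain ⟨_, -, -, e, -⟩ := exists_marked α u₀ 0
    exact ⟨e⟩
  let φ : FreeMonoid (P.parts × A) →* FreeMonoid (WFAlphabet α) := FreeMonoid.lift fun l =>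
    FreeMonoid.ofList (emit α (2 ^ Nat.card (WithOne S)) (r l.1 ++ [l.2]))
  have hφ : ∀ u : ℕ → A, ∃ w, WellFormed α w ∧ (wfEval α).inf w = α.inf u ∧
      (P.tag u ∈ omegaPreimage φ K ↔ w ∈ K) := by
    intro u
    obtain ⟨w, h1, h2, h3⟩ := exists_isConcat_emit α u
    refine ⟨w, h1, h2, mem_omegaPreimage_iff ?_⟩
    convert h3 using 2 with i
    simp only [φ, FreeMonoid.lift_eval_of, FreeMonoid.toList_ofList, DPartition.tag]
    rw [hr, ← List.rtake_concat_succ, ← pre_succ, emit_rtake hn]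
  refine ⟨P.tag ⁻¹' omegaPreimage φ K, ⟨P, _, hinv _ _ φ K hK, rfl⟩, fun u hu => ?_,
    Set.eq_empty_of_forall_notMem ?_⟩
  · obtain ⟨w, h1, h2, h3⟩ := hφ u
    exact h3.2 (hsub ⟨h1, u, hu, h2.symm⟩)
  · rintro u ⟨hu, hu'⟩
    obtain ⟨w, h1, h2, h3⟩ := hφ u
    have : w ∈ K ∩ wfLang α L₂ := ⟨h3.1 hu, h1, u, hu', h2.symm⟩
    rw [hdisj] at this
    exact this

theorem SUk_subset_SU (k : ℕ) (A : Type u) [Finite A] : SUk k A ⊆ SU A :=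
  BooleanSubalgebra.closure_mono fun _ ⟨x, _, hK⟩ => ⟨x, hK⟩

theorem enrichment_mono (C : OmegaClass.{u}) {D D' : LangClass.{u}}
    (h : ∀ (A : Type u) [Finite A], D A ⊆ D' A) (A : Type u) [Finite A] :
    enrichment C D A ⊆ enrichment C D' A := by
  rintro _ ⟨P, L, hL, rfl⟩
  exact ⟨⟨P.parts, P.isPartition, fun Q hQ => h A (P.mem_class Q hQ)⟩, L, hL, rfl⟩

end OmegaSep

theorem corollary7p2 {A : Type u} [Finite A] {S : Type u} {T : Type v} [Semigroup S]
    [Finite S] [Finite T] [OmegaSep.OmegaSemigroup S T]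
    (α : OmegaSep.OmegaHom (FreeSemigroup A) (ℕ → A) S T)
    (C : OmegaSep.OmegaClass.{u}) (hC : C.IsLattice) (hinv : C.ClosedUnderInverseImage)
    (L₁ L₂ : Set (ℕ → A)) (h₁ : α.Recognizes L₁) (h₂ : α.Recognizes L₂) :
    List.TFAE
      [(OmegaSep.enrichment C OmegaSep.SU).Separable L₁ L₂,
       (OmegaSep.enrichment C (OmegaSep.SUk (2 ^ (3 * Nat.card S + 1)))).Separable L₁ L₂,
       C.Separable (OmegaSep.wfLang α L₁) (OmegaSep.wfLang α L₂)] := by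
  tfae_have 2 → 1 := fun ⟨K, hK, h⟩ =>
    ⟨K, OmegaSep.enrichment_mono C (fun A _ => OmegaSep.SUk_subset_SU _ A) A hK, h⟩
  tfae_have 1 → 3 := OmegaSep.separable_wfLang_of_enrichment hinv h₁ h₂
  tfae_have 3 → 2 := by
    intro h
    -- Without infinite words, `S` may be empty and the numerical bound may fail, but the empty
    -- language then separates.
    rcases isEmpty_or_nonempty (ℕ → A) with hA | ⟨⟨u₀⟩⟩
    · obtain ⟨P, -, -⟩ := OmegaSep.exists_partition_rtake A (2 ^ (3 * Nat.card S + 1))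
      exact ⟨_, ⟨P, ∅, hC.empty_mem _, rfl⟩, fun u => hA.elim u, Set.eq_empty_of_isEmpty _⟩
    · refine OmegaSep.separable_enrichment_of_wfLang hinv ?_ h u₀
      have : Nonempty S := ⟨α.fin (FreeSemigroup.of (u₀ 0))⟩
      have hpos : 0 < Nat.card S := Nat.card_pos
      have hcard : Nat.card (WithOne S) = Nat.card S + 1 := Finite.card_option
      rw [hcard, ← pow_succ']
      exact (Nat.pow_le_pow_right two_pos (by omega)).trans (Nat.le_succ _)
  tfae_finish
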